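/- For a positive integer $n$ let $\omega_n=e^{2\pi \mathrm{i}/n}$, let $Q_n=\mathrm{diag}(1,\omega_n,\dots,\omega_n^{n-1})$ and $P_n=(\delta_{i,j-1})_{i,j\in\mathbb{Z}_n}$ be the generalized Pauli matrices in $\mathrm{GL}(n,\mathbb{C})$, and let $\Pi_n=\langle Q_n,P_n\rangle\le \mathrm{GL}(n,\mathbb{C})$. For an invertible matrix $M$ let $\mathrm{Ad}_M$ denote the inner automorphism $X\mapsto MXM^{-1}$ of the general linear group containing $M$. Let $\mathcal{P}_n=\langle \mathrm{Ad}_{Q_n},\mathrm{Ad}_{P_n}\rangle=\{\mathrm{Ad}_{Q_n^iP_n^j} : i,j\in\mathbb{Z}_n\}$, and let $\mathcal{N}(\mathcal{P}_n)$ be the normalizer of $\mathcal{P}_n$ in the group $\mathrm{Int}(\mathrm{GL}(n,\mathbb{C}))$ of inner automorphisms of $\mathrm{GL}(n,\mathbb{C})$. For positive integers $n,m$ put $$\mathcal{P}_n\otimes\mathcal{P}_m=\{\mathrm{Ad}_{A\otimes B} : A\in\Pi_n,\ B\in\Pi_m\}\subseteq \mathrm{Int}(\mathrm{GL}(nm,\mathbb{C})),$$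 where $A\otimes B$ is the Kronecker product, let $\mathcal{N}(\mathcal{P}_n\otimes\mathcal{P}_m)$ be the normalizer of $\mathcal{P}_n\otimes\mathcal{P}_m$ in $\mathrm{Int}(\mathrm{GL}(nm,\mathbb{C}))$, and put $$\mathcal{N}(\mathcal{P}_n)\otimes\mathcal{N}(\mathcal{P}_m)=\{\mathrm{Ad}_{A\otimes B} : \mathrm{Ad}_A\in\mathcal{N}(\mathcal{P}_n),\ \mathrm{Ad}_B\in\mathcal{N}(\mathcal{P}_m)\}.$$ Then, for all positive integers $n$ and $m$, $$\mathcal{N}(\mathcal{P}_n\otimes\mathcal{P}_m)=\mathcal{N}(\mathcal{P}_n)\otimes\mathcal{N}(\mathcal{P}_m)\quad\Longleftrightarrow\quad \gcd(n,m)=1.$$ -/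

import Mathlib

open scoped Kronecker

noncomputable section

/-- The group `Int G` of inner automorphisms of a group `G`, inside `MulAut G`. -/
abbrev InnerAut (G : Type*) [Group G] : Subgroup (MulAut G) :=
  (MulAut.conj : G →* MulAut G).range

/-- The inner automorphism `Ad_M : X ↦ M * X * M⁻¹`, as an element of `Int G`. -/
def Ad {G : Type*} [Group G] : G →* InnerAut G :=
  (MulAut.conj : G →* MulAut G).rangeRestrict

theorem Ad_apply {G : Type*} [Group G] (M X : G) : (Ad M : MulAut G) X = M * X * M⁻¹ :=
  rfl

/-- The primitive root of unity `ω_n = exp (2 π i / n)`. -/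
def omegaRoot (n : ℕ) : ℂ := Complex.exp (2 * Real.pi * Complex.I / n)

/-- `Q_n = diag (1, ω_n, ω_n ^ 2, …, ω_n ^ (n - 1))`, as an element of `GL(n, ℂ)`;
rows and columns are indexed by `ZMod n`. -/
def pauliQ (n : ℕ) [NeZero n] : GL (ZMod n) ℂ where
  val := Matrix.diagonal fun i => omegaRoot n ^ i.val
  inv := Matrix.diagonal fun i => (omegaRoot n ^ i.val)⁻¹
  val_inv := by
    rw [Matrix.diagonal_mul_diagonal, ← Matrix.diagonal_one]
    congr 1
    funext i
    exact mul_inv_cancel₀ (pow_ne_zero _ (Complex.exp_ne_zero _))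
  inv_val := by
    rw [Matrix.diagonal_mul_diagonal, ← Matrix.diagonal_one]
    congr 1
    funext i
    exact inv_mul_cancel₀ (pow_ne_zero _ (Complex.exp_ne_zero _))

/-- The cyclic shift `P_n`, with entries `δ_{i, j - 1}` for `i, j` in `ZMod n`, as an element
of `GL(n, ℂ)`. -/
def pauliP (n : ℕ) [NeZero n] : GL (ZMod n) ℂ where
  val := Matrix.of fun i j => if i = j - 1 then 1 else 0
  inv := Matrix.of fun i j => if j = i - 1 then 1 else 0
  val_inv := by
    ext i j
    have h (a k : ZMod n) : a = k - 1 ↔ k = a + 1 := by rw [eq_sub_iff_add_eq, eq_comm]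
    simp [Matrix.mul_apply, Matrix.one_apply, h, eq_comm]
  inv_val := by
    ext i j
    simp [Matrix.mul_apply, Matrix.one_apply, eq_comm]

/-- The finite Heisenberg group `Π_n`: the subgroup of `GL(n, ℂ)` generated by `Q_n` and `P_n`. -/
def heisenbergGroup (n : ℕ) [NeZero n] : Subgroup (GL (ZMod n) ℂ) :=
  Subgroup.closure {pauliQ n, pauliP n}

/-- The group `𝒫_n` generated by `Ad_{Q_n}` and `Ad_{P_n}` in `Int(GL(n, ℂ))`. -/
def pauliGroup (n : ℕ) [NeZero n] : Subgroup (InnerAut (GL (ZMod n) ℂ)) :=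
  Subgroup.closure {Ad (pauliQ n), Ad (pauliP n)}

/-- The tensor (Kronecker) product of invertible matrices, as a homomorphism
`GL(n, ℂ) × GL(m, ℂ) → GL(nm, ℂ)`; rows and columns of the matrices in `GL(nm, ℂ)` are indexed
by pairs. -/
def tensorHom (n m : ℕ) [NeZero n] [NeZero m] :
    GL (ZMod n) ℂ × GL (ZMod m) ℂ →* GL (ZMod n × ZMod m) ℂ where
  toFun p :=
    { val := (p.1 : Matrix (ZMod n) (ZMod n) ℂ) ⊗ₖ (p.2 : Matrix (ZMod m) (ZMod m) ℂ)
      inv := ((p.1⁻¹ : GL (ZMod n) ℂ) : Matrix (ZMod n) (ZMod n) ℂ) ⊗ₖ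
        ((p.2⁻¹ : GL (ZMod m) ℂ) : Matrix (ZMod m) (ZMod m) ℂ)
      val_inv := by
        rw [← Matrix.mul_kronecker_mul, Units.mul_inv, Units.mul_inv, Matrix.one_kronecker_one]
      inv_val := by
        rw [← Matrix.mul_kronecker_mul, Units.inv_mul, Units.inv_mul, Matrix.one_kronecker_one] }
  map_one' := Units.ext Matrix.one_kronecker_one
  map_mul' _ _ := Units.ext (Matrix.mul_kronecker_mul _ _ _ _)

/-- For subgroups `H` of `GL(n, ℂ)` and `K` of `GL(m, ℂ)`, the subgroup
`{Ad_{A ⊗ B} | A ∈ H, B ∈ K}` of `Int(GL(nm, ℂ))`. -/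
def adTensor {n m : ℕ} [NeZero n] [NeZero m]
    (H : Subgroup (GL (ZMod n) ℂ)) (K : Subgroup (GL (ZMod m) ℂ)) :
    Subgroup (InnerAut (GL (ZMod n × ZMod m) ℂ)) :=
  (H.prod K).map (Ad.comp (tensorHom n m))

theorem mem_adTensor {n m : ℕ} [NeZero n] [NeZero m]
    {H : Subgroup (GL (ZMod n) ℂ)} {K : Subgroup (GL (ZMod m) ℂ)}
    {x : InnerAut (GL (ZMod n × ZMod m) ℂ)} :
    x ∈ adTensor H K ↔ ∃ A ∈ H, ∃ B ∈ K, Ad (tensorHom n m (A, B)) = x := by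
  simp [adTensor, Subgroup.mem_map, Subgroup.mem_prod, and_assoc]

/-- `𝒫_n ⊗ 𝒫_m = {Ad_{A ⊗ B} | A ∈ Π_n, B ∈ Π_m}`. -/
def pauliTensor (n m : ℕ) [NeZero n] [NeZero m] :
    Subgroup (InnerAut (GL (ZMod n × ZMod m) ℂ)) :=
  adTensor (heisenbergGroup n) (heisenbergGroup m)

/-- `𝒩(𝒫_n)`, the normalizer of `𝒫_n` in `Int(GL(n, ℂ))`. -/
def pauliNormalizer (n : ℕ) [NeZero n] : Subgroup (InnerAut (GL (ZMod n) ℂ)) :=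
  Subgroup.normalizer (pauliGroup n)

/-- `𝒩(𝒫_n ⊗ 𝒫_m)`, the normalizer of `𝒫_n ⊗ 𝒫_m` in `Int(GL(nm, ℂ))`. -/
def pauliTensorNormalizer (n m : ℕ) [NeZero n] [NeZero m] :
    Subgroup (InnerAut (GL (ZMod n × ZMod m) ℂ)) :=
  Subgroup.normalizer (pauliTensor n m)

/-- `𝒩(𝒫_n) ⊗ 𝒩(𝒫_m) = {Ad_{A ⊗ B} | Ad_A ∈ 𝒩(𝒫_n), Ad_B ∈ 𝒩(𝒫_m)}`. -/
def normalizerTensor (n m : ℕ) [NeZero n] [NeZero m] :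
    Subgroup (InnerAut (GL (ZMod n × ZMod m) ℂ)) :=
  adTensor ((pauliNormalizer n).comap Ad) ((pauliNormalizer m).comap Ad)

end

open Matrix

/-! ### Inner automorphisms of `GL` and of the full matrix algebra. -/

section InnerAutomorphisms

variable {ι : Type*} [Fintype ι] [DecidableEq ι]

/-! The inclusion of the tensored normalizers in the normalizer always holds.

If `gcd n m = 1`, let `Ad M` normalize `𝒫_n ⊗ 𝒫_m`. Since `𝒫_n` and `𝒫_m` have coprime exponents,
orders of elements show that conjugation by `M` preserves `𝒫_n ⊗ 1` and `1 ⊗ 𝒫_m`. The commutant of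
`1 ⊗ Π_m` is `M_n(ℂ) ⊗ 1`, so `M` also preserves this algebra and, by Skolem–Noether, acts on it as
some `A`. Then `(A ⊗ 1)⁻¹ M` commutes with `M_n(ℂ) ⊗ 1`, hence equals `1 ⊗ B`, and `M = A ⊗ B`
(`exists_eq_tensorHom_of_coprime`).

If `d = gcd n m > 1`, take a primitive `d`-th root of unity `ζ`. The diagonal matrix with entries `ζ
^ (i * j)` fixes the `Q`'s and multiplies each `P` by a power of the other factor's `Q`, so it
normalizes; it is not a multiple of a tensor product (`not_pauliTensorNormalizer_le`). -/

theorem Ad_eq_one_iff {M : GL ι ℂ} :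
    Ad M = 1 ↔ ∃ c : ℂ, (M : Matrix ι ι ℂ) = c • (1 : Matrix ι ι ℂ) := by
  have h : Ad M = 1 ↔ M ∈ Subgroup.center (GL ι ℂ) := by
    rw [Subgroup.mem_center_iff, Subtype.ext_iff, MulEquiv.ext_iff]
    exact forall_congr' fun X => by
      rw [Ad_apply, mul_inv_eq_iff_eq_mul, eq_comm]
      rfl
  rw [h, Matrix.GeneralLinearGroup.mem_center_iff_val_mem_range_scalar]
  simp only [Set.mem_range, eq_comm, Matrix.scalar_apply, Matrix.smul_one_eq_diagonal]

theorem Ad_eq_Ad_iff {M N : GL ι ℂ} :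
    Ad M = Ad N ↔ ∃ c : ℂ, (M : Matrix ι ι ℂ) = c • (N : Matrix ι ι ℂ) := by
  rw [← mul_inv_eq_one, ← map_inv, ← map_mul, Ad_eq_one_iff]
  refine exists_congr fun c => ?_
  rw [Units.val_mul, Units.mul_inv_eq_iff_eq_mul, smul_mul_assoc, one_mul]

/-- Skolem–Noether for matrices, transported from endomorphisms of `ι → ℂ`. -/
theorem AlgEquiv.exists_eq_conj_generalLinearGroup (f : Matrix ι ι ℂ ≃ₐ[ℂ] Matrix ι ι ℂ) :
    ∃ A : GL ι ℂ, ∀ X, f X = A.val * X * (A⁻¹).val := by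
  obtain ⟨T, hT⟩ := ((Matrix.toLinAlgEquiv'.symm.trans f).trans
    (Matrix.toLinAlgEquiv' (R := ℂ) (n := ι))).eq_linearEquivConjAlgEquiv
  refine ⟨⟨LinearMap.toMatrixAlgEquiv' T.toLinearMap,
    LinearMap.toMatrixAlgEquiv' T.symm.toLinearMap, ?_, ?_⟩, fun X => ?_⟩
  · rw [← LinearMap.toMatrixAlgEquiv'_mul]
    convert LinearMap.toMatrixAlgEquiv'_id using 2
    ext; simp
  · rw [← LinearMap.toMatrixAlgEquiv'_mul]
    convert LinearMap.toMatrixAlgEquiv'_id using 2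
    ext; simp
  · have h := congrArg LinearMap.toMatrixAlgEquiv' (DFunLike.congr_fun hT (Matrix.toLinAlgEquiv' X))
    simp only [AlgEquiv.trans_apply, AlgEquiv.symm_apply_apply,
      LinearMap.toMatrixAlgEquiv'_toLinAlgEquiv'] at h
    rw [h, LinearEquiv.conjAlgEquiv_apply, LinearMap.toMatrixAlgEquiv'_comp,
      LinearMap.toMatrixAlgEquiv'_comp, LinearMap.toMatrixAlgEquiv'_toLinAlgEquiv']
    simp [Matrix.mul_assoc]

theorem Subgroup.mem_normalizer_of_conj_mem {G : Type*} [Group G] {H : Subgroup G} {x : G}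
    (h₁ : ∀ h ∈ H, x * h * x⁻¹ ∈ H) (h₂ : ∀ h ∈ H, x⁻¹ * h * x ∈ H) :
    x ∈ Subgroup.normalizer (H : Set G) := by
  rw [Subgroup.mem_normalizer_iff]
  refine fun h => ⟨h₁ h, fun hh => ?_⟩
  simpa [mul_assoc] using h₂ _ hh

end InnerAutomorphisms

section Kronecker

variable {ι κ : Type*}

theorem kronecker_one_injective [DecidableEq κ] [Nonempty κ] :
    Function.Injective fun Y : Matrix ι ι ℂ => Y ⊗ₖ (1 : Matrix κ κ ℂ) := by
  intro Y Y' h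
  ext i i'
  simpa using congrFun (congrFun h (i, Classical.arbitrary κ)) (i', Classical.arbitrary κ)

theorem one_kronecker_injective [DecidableEq ι] [Nonempty ι] :
    Function.Injective fun Y : Matrix κ κ ℂ => (1 : Matrix ι ι ℂ) ⊗ₖ Y := by
  intro Y Y' h
  ext j j'
  simpa using congrFun (congrFun h (Classical.arbitrary ι, j)) (Classical.arbitrary ι, j')

end Kronecker

/-! ### Pauli matrices: powers, commutation up to a scalar, exponent. -/

section Pauli

variable {n : ℕ} [NeZero n]

theorem isPrimitiveRoot_omegaRoot (n : ℕ) [NeZero n] : IsPrimitiveRoot (omegaRoot n) n :=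
  Complex.isPrimitiveRoot_exp n (NeZero.ne n)

/-- The wrap-around from `n - 1` to `0` is absorbed by `z ^ n = 1`. -/
theorem pow_val_add_one {z : ℂ} (hz : z ^ n = 1) (i : ZMod n) :
    z ^ (i + 1).val = z ^ i.val * z := by
  rw [ZMod.val_add, ← pow_eq_pow_mod _ hz, pow_add, ZMod.val_one_eq_one_mod,
    ← pow_eq_pow_mod _ hz, pow_one]

theorem pauliQ_pow_val (k : ℕ) : ((pauliQ n ^ k : GL (ZMod n) ℂ) : Matrix (ZMod n) (ZMod n) ℂ) =
    Matrix.diagonal fun i => (omegaRoot n ^ k) ^ i.val := by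
  rw [Units.val_pow_eq_pow_val, pauliQ, Matrix.diagonal_pow]
  congr 1
  funext i
  simp [← pow_mul, mul_comm]

theorem pauliP_pow_val (k : ℕ) : ((pauliP n ^ k : GL (ZMod n) ℂ) : Matrix (ZMod n) (ZMod n) ℂ) =
    Matrix.of fun i j : ZMod n => if j = i + (k : ZMod n) then 1 else 0 := by
  induction k with
  | zero =>
    ext i j
    simp [Matrix.one_apply, eq_comm]
  | succ k ih =>
    rw [pow_succ', Units.val_mul, ih]
    ext i j
    rw [Matrix.mul_apply, Finset.sum_eq_single (i + 1)]
    · simp [pauliP, add_assoc, add_comm (k : ZMod n)]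
    · intro l _ hl
      simp [pauliP, eq_sub_iff_add_eq, hl.symm]
    · simp

theorem pauliQ_pow_self : pauliQ n ^ n = 1 := by
  refine Units.ext ?_
  rw [pauliQ_pow_val, (isPrimitiveRoot_omegaRoot n).pow_eq_one]
  simp

theorem pauliP_pow_self : pauliP n ^ n = 1 := by
  refine Units.ext ?_
  rw [pauliP_pow_val]
  ext i j
  simp [Matrix.one_apply, eq_comm]

theorem Ad_pauliP_mul_Ad_pauliQ :
    Ad (pauliP n) * Ad (pauliQ n) = Ad (pauliQ n) * Ad (pauliP n) := by
  rw [← map_mul, ← map_mul, Ad_eq_Ad_iff]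
  refine ⟨omegaRoot n, ?_⟩
  ext i j
  simp only [Units.val_mul, pauliP, pauliQ, Matrix.mul_diagonal, Matrix.diagonal_mul,
    Matrix.smul_apply, Matrix.of_apply, smul_eq_mul, eq_sub_iff_add_eq]
  split_ifs with h
  · rw [← h, pow_val_add_one (isPrimitiveRoot_omegaRoot n).pow_eq_one]
    ring
  · simp

theorem map_Ad_heisenbergGroup : (heisenbergGroup n).map Ad = pauliGroup n := by
  rw [heisenbergGroup, MonoidHom.map_closure, Set.image_pair, pauliGroup]

theorem Ad_mem_pauliGroup_iff {A : GL (ZMod n) ℂ} :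
    Ad A ∈ pauliGroup n ↔ ∃ C ∈ heisenbergGroup n, Ad C = Ad A := by
  rw [← map_Ad_heisenbergGroup, Subgroup.mem_map]

/-- The two generators commute modulo scalars and have order dividing `n`, so the abelian group they
generate has exponent dividing `n`. -/
theorem pow_eq_one_of_mem_pauliGroup {x : InnerAut (GL (ZMod n) ℂ)} (hx : x ∈ pauliGroup n) :
    x ^ n = 1 := by
  have hcomm : ∀ y ∈ pauliGroup n, ∀ z ∈ pauliGroup n, y * z = z * y := by
    intro y hy z hz
    have hc : IsMulCommutative (pauliGroup n) := by
      refine Subgroup.isMulCommutative_closure ?_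
      rintro a (rfl | rfl) b (rfl | rfl)
      · rfl
      · exact Ad_pauliP_mul_Ad_pauliQ.symm
      · exact Ad_pauliP_mul_Ad_pauliQ
      · rfl
    exact congrArg Subtype.val (hc.is_comm.comm ⟨y, hy⟩ ⟨z, hz⟩)
  induction hx using Subgroup.closure_induction with
  | mem x hx =>
    obtain rfl | rfl := hx
    · rw [← map_pow, pauliQ_pow_self, map_one]
    · rw [← map_pow, pauliP_pow_self, map_one]
  | one => exact one_pow n
  | mul x y hx hy ihx ihy => rw [Commute.mul_pow (hcomm x hx y hy), ihx, ihy, one_mul]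
  | inv x hx ih => rw [inv_pow, ih, inv_one]

theorem Ad_pow_eq_one {C : GL (ZMod n) ℂ} (hC : C ∈ heisenbergGroup n) : Ad C ^ n = 1 :=
  pow_eq_one_of_mem_pauliGroup (Ad_mem_pauliGroup_iff.2 ⟨C, hC, rfl⟩)

theorem pauliQ_mem : pauliQ n ∈ heisenbergGroup n := Subgroup.subset_closure (.inl rfl)

theorem pauliP_mem : pauliP n ∈ heisenbergGroup n := Subgroup.subset_closure (.inr rfl)

end Pauli

/-! ### Tensor products: uniqueness of factors, commutants, induced automorphisms. -/

section Tensor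

variable {n m : ℕ} [NeZero n] [NeZero m]

theorem tensorHom_val (A : GL (ZMod n) ℂ) (B : GL (ZMod m) ℂ) :
    (tensorHom n m (A, B)).val = A.val ⊗ₖ B.val := rfl

theorem tensorHom_mul_tensorHom (A C : GL (ZMod n) ℂ) (B D : GL (ZMod m) ℂ) :
    tensorHom n m (A, B) * tensorHom n m (C, D) = tensorHom n m (A * C, B * D) :=
  (map_mul (tensorHom n m) (A, B) (C, D)).symm

theorem tensorHom_inv (A : GL (ZMod n) ℂ) (B : GL (ZMod m) ℂ) :
    (tensorHom n m (A, B))⁻¹ = tensorHom n m (A⁻¹, B⁻¹) :=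
  (map_inv (tensorHom n m) (A, B)).symm

theorem Ad_tensorHom_eq_one_iff {A : GL (ZMod n) ℂ} {B : GL (ZMod m) ℂ} :
    Ad (tensorHom n m (A, B)) = 1 ↔ Ad A = 1 ∧ Ad B = 1 := by
  constructor
  · intro h
    obtain ⟨c, hc⟩ := Ad_eq_one_iff.1 h
    have hc' (i i' j j') := congrFun (congrFun hc (i, j)) (i', j')
    simp only [tensorHom_val, Matrix.kroneckerMap_apply, Matrix.smul_apply, Matrix.one_apply,
      Prod.mk.injEq, smul_eq_mul, mul_ite, mul_one, mul_zero] at hc'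
    have hA : ∃ i i', A.val i i' ≠ 0 := by
      by_contra! h0
      exact A.ne_zero (Matrix.ext h0)
    have hB : ∃ j j', B.val j j' ≠ 0 := by
      by_contra! h0
      exact B.ne_zero (Matrix.ext h0)
    obtain ⟨i, i', hA⟩ := hA
    obtain ⟨j, j', hB⟩ := hB
    constructor
    -- Freezing a nonzero entry of `B` in `A ⊗ B = c • 1` solves for `A`.
    · refine Ad_eq_one_iff.2 ⟨(if j = j' then c else 0) / B.val j j', ?_⟩
      ext k k'
      rw [Matrix.smul_apply, smul_eq_mul, div_mul_eq_mul_div, eq_div_iff hB, hc',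
        Matrix.one_apply]
      split_ifs <;> simp_all
    · refine Ad_eq_one_iff.2 ⟨(if i = i' then c else 0) / A.val i i', ?_⟩
      ext k k'
      rw [Matrix.smul_apply, smul_eq_mul, div_mul_eq_mul_div, eq_div_iff hA, mul_comm, hc',
        Matrix.one_apply]
      split_ifs <;> simp_all
  · rintro ⟨hA, hB⟩
    obtain ⟨a, ha⟩ := Ad_eq_one_iff.1 hA
    obtain ⟨b, hb⟩ := Ad_eq_one_iff.1 hB
    refine Ad_eq_one_iff.2 ⟨a * b, ?_⟩
    rw [tensorHom_val, ha, hb, Matrix.smul_kronecker, Matrix.kronecker_smul,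
      Matrix.one_kronecker_one, smul_smul]

theorem Ad_tensorHom_eq_iff {A C : GL (ZMod n) ℂ} {B D : GL (ZMod m) ℂ} :
    Ad (tensorHom n m (A, B)) = Ad (tensorHom n m (C, D)) ↔ Ad A = Ad C ∧ Ad B = Ad D := by
  rw [← mul_inv_eq_one, ← map_inv, ← map_mul, tensorHom_inv, tensorHom_mul_tensorHom,
    Ad_tensorHom_eq_one_iff, map_mul, map_mul, map_inv, map_inv, mul_inv_eq_one, mul_inv_eq_one]

theorem Ad_tensorHom_mem_pauliTensor_iff {A : GL (ZMod n) ℂ} {B : GL (ZMod m) ℂ} :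
    Ad (tensorHom n m (A, B)) ∈ pauliTensor n m ↔ Ad A ∈ pauliGroup n ∧ Ad B ∈ pauliGroup m := by
  rw [pauliTensor, mem_adTensor]
  simp only [Ad_tensorHom_eq_iff, Ad_mem_pauliGroup_iff]
  constructor
  · rintro ⟨C, hC, D, hD, h₁, h₂⟩
    exact ⟨⟨C, hC, h₁⟩, ⟨D, hD, h₂⟩⟩
  · rintro ⟨⟨C, hC, h₁⟩, ⟨D, hD, h₂⟩⟩
    exact ⟨C, hC, D, hD, h₁, h₂⟩

theorem Ad_tensorHom_mem_pauliTensorNormalizer {A : GL (ZMod n) ℂ} {B : GL (ZMod m) ℂ}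
    (hA : Ad A ∈ pauliNormalizer n) (hB : Ad B ∈ pauliNormalizer m) :
    Ad (tensorHom n m (A, B)) ∈ pauliTensorNormalizer n m := by
  have key (A : GL (ZMod n) ℂ) (B : GL (ZMod m) ℂ) (hA : Ad A ∈ pauliNormalizer n)
      (hB : Ad B ∈ pauliNormalizer m) : ∀ h ∈ pauliTensor n m,
      Ad (tensorHom n m (A, B)) * h * (Ad (tensorHom n m (A, B)))⁻¹ ∈ pauliTensor n m := by
    intro h hh
    obtain ⟨C, hC, D, hD, rfl⟩ := mem_adTensor.1 hh
    rw [← map_mul, ← map_inv, ← map_mul, tensorHom_inv, tensorHom_mul_tensorHom,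
      tensorHom_mul_tensorHom, Ad_tensorHom_mem_pauliTensor_iff]
    simp only [map_mul, map_inv]
    exact ⟨(Subgroup.mem_normalizer_iff.1 hA _).1 (Ad_mem_pauliGroup_iff.2 ⟨C, hC, rfl⟩),
      (Subgroup.mem_normalizer_iff.1 hB _).1 (Ad_mem_pauliGroup_iff.2 ⟨D, hD, rfl⟩)⟩
  refine Subgroup.mem_normalizer_of_conj_mem (key A B hA hB) fun h hh => ?_
  have := key A⁻¹ B⁻¹ (map_inv Ad A ▸ inv_mem hA) (map_inv Ad B ▸ inv_mem hB) h hh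
  rwa [← tensorHom_inv, map_inv, inv_inv] at this

theorem normalizerTensor_le : normalizerTensor n m ≤ pauliTensorNormalizer n m := by
  intro x hx
  obtain ⟨A, hA, B, hB, rfl⟩ := mem_adTensor.1 hx
  exact Ad_tensorHom_mem_pauliTensorNormalizer hA hB

/-- The eigenvalues of `Q_m` are distinct, so commuting with `1 ⊗ Q_m` makes `Z` diagonal in the
second index; commuting with the shift `1 ⊗ P_m` makes its diagonal blocks equal. -/
theorem exists_eq_kronecker_one {Z : Matrix (ZMod n × ZMod m) (ZMod n × ZMod m) ℂ}
    (hQ : Commute Z (tensorHom n m (1, pauliQ m)).val)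
    (hP : Commute Z (tensorHom n m (1, pauliP m)).val) :
    ∃ Y : Matrix (ZMod n) (ZMod n) ℂ, Z = Y ⊗ₖ (1 : Matrix (ZMod m) (ZMod m) ℂ) := by
  have hdiag (i i' j j') (hj : j ≠ j') : Z (i, j) (i', j') = 0 := by
    have h := congrFun (congrFun hQ (i, j)) (i', j')
    have hone : (1 : Matrix (ZMod n) (ZMod n) ℂ) = Matrix.diagonal fun _ => 1 := rfl
    simp only [tensorHom_val, pauliQ, Units.val_one, hone, Matrix.diagonal_kronecker_diagonal,
      Matrix.mul_diagonal, Matrix.diagonal_mul, one_mul] at h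
    have h0 : Z (i, j) (i', j') * (omegaRoot m ^ j'.val - omegaRoot m ^ j.val) = 0 := by
      linear_combination h
    refine (mul_eq_zero.1 h0).resolve_right fun h1 => hj ?_
    exact ZMod.val_injective m ((isPrimitiveRoot_omegaRoot m).pow_inj (ZMod.val_lt _)
      (ZMod.val_lt _) (sub_eq_zero.1 h1).symm)
  have hshift (i i' j) : Z (i, j) (i', j) = Z (i, j + 1) (i', j + 1) := by
    have h := congrFun (congrFun hP (i, j)) (i', j + 1)
    simpa [tensorHom_val, pauliP, Matrix.mul_apply, Fintype.sum_prod_type, Matrix.one_apply,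
      eq_sub_iff_add_eq, ite_and] using h
  have hconst (i i' j) : Z (i, j) (i', j) = Z (i, 0) (i', 0) := by
    rw [← ZMod.natCast_zmod_val j]
    induction j.val with
    | zero => simp
    | succ k ih => rw [Nat.cast_succ, ← hshift, ih]
  refine ⟨Matrix.of fun i i' => Z (i, 0) (i', 0), ?_⟩
  ext ⟨i, j⟩ ⟨i', j'⟩
  rw [Matrix.kroneckerMap_apply, Matrix.of_apply, Matrix.one_apply]
  split_ifs with h
  · obtain rfl : j = j' := h
    rw [hconst, mul_one]
  · rw [hdiag _ _ _ _ h, mul_zero]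

theorem exists_eq_one_kronecker {Z : Matrix (ZMod n × ZMod m) (ZMod n × ZMod m) ℂ}
    (hQ : Commute Z (tensorHom n m (pauliQ n, 1)).val)
    (hP : Commute Z (tensorHom n m (pauliP n, 1)).val) :
    ∃ Y : Matrix (ZMod m) (ZMod m) ℂ, Z = (1 : Matrix (ZMod n) (ZMod n) ℂ) ⊗ₖ Y := by
  -- Swapping the tensor factors reduces to the previous commutant.
  have key (A : GL (ZMod n) ℂ) (h : Commute Z (tensorHom n m (A, 1)).val) :
      Commute (Z.submatrix Prod.swap Prod.swap) (tensorHom m n (1, A)).val := by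
    have h' := congrArg (fun W => W.submatrix Prod.swap Prod.swap) h.eq
    have hsw : (tensorHom m n (1, A)).val =
        (tensorHom n m (A, 1)).val.submatrix Prod.swap Prod.swap := by
      ext ⟨j, i⟩ ⟨j', i'⟩
      simp [tensorHom_val, mul_comm]
    rw [hsw]
    change _ * _ = _ * _
    simpa only [Matrix.submatrix_mul _ _ _ _ _ Prod.swap_bijective] using h'
  obtain ⟨Y, hY⟩ := exists_eq_kronecker_one (key _ hQ) (key _ hP)
  refine ⟨Y, ?_⟩
  ext ⟨i, j⟩ ⟨i', j'⟩
  simpa [mul_comm] using congrFun (congrFun hY (j, i)) (j', i')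

theorem kronecker_one_commute_one_kronecker (X : Matrix (ZMod n) (ZMod n) ℂ)
    (Y : Matrix (ZMod m) (ZMod m) ℂ) :
    Commute (X ⊗ₖ (1 : Matrix (ZMod m) (ZMod m) ℂ)) ((1 : Matrix (ZMod n) (ZMod n) ℂ) ⊗ₖ Y) := by
  change _ * _ = _ * _
  rw [← Matrix.mul_kronecker_mul, ← Matrix.mul_kronecker_mul]
  simp

/-- If conjugation by `M` maps `M_n(ℂ) ⊗ 1` into itself, then it acts there as conjugation by
some `A ∈ GL(n, ℂ)`. -/
theorem exists_conj_kronecker_one {M : GL (ZMod n × ZMod m) ℂ}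
    (hM : ∀ X : Matrix (ZMod n) (ZMod n) ℂ, ∃ Y : Matrix (ZMod n) (ZMod n) ℂ,
      M.val * (X ⊗ₖ (1 : Matrix (ZMod m) (ZMod m) ℂ)) * (M⁻¹).val = Y ⊗ₖ 1) :
    ∃ A : GL (ZMod n) ℂ, ∀ X : Matrix (ZMod n) (ZMod n) ℂ,
      M.val * (X ⊗ₖ (1 : Matrix (ZMod m) (ZMod m) ℂ)) * (M⁻¹).val =
        (A.val * X * (A⁻¹).val) ⊗ₖ 1 := by
  choose f hf using hM
  have inj := kronecker_one_injective (ι := ZMod n) (κ := ZMod m)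
  let F : Matrix (ZMod n) (ZMod n) ℂ →ₐ[ℂ] Matrix (ZMod n) (ZMod n) ℂ := AlgHom.ofLinearMap
    { toFun := f
      map_add' := fun X Y => inj <| by
        simp only [← hf, Matrix.add_kronecker, Matrix.mul_add, Matrix.add_mul]
      map_smul' := fun c X => inj <| by
        simp only [← hf, Matrix.smul_kronecker, Matrix.mul_smul, Matrix.smul_mul,
          RingHom.id_apply] }
    (inj <| by
      change f 1 ⊗ₖ 1 = 1 ⊗ₖ 1
      rw [← hf, Matrix.one_kronecker_one, mul_one, Units.mul_inv])
    (fun X Y => inj <| by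
      change f (X * Y) ⊗ₖ 1 = (f X * f Y) ⊗ₖ 1
      have h : (X * Y) ⊗ₖ (1 : Matrix (ZMod m) (ZMod m) ℂ) = (X ⊗ₖ 1) * (Y ⊗ₖ 1) := by
        rw [← Matrix.mul_kronecker_mul, mul_one]
      have h' : (f X * f Y) ⊗ₖ (1 : Matrix (ZMod m) (ZMod m) ℂ) = (f X ⊗ₖ 1) * (f Y ⊗ₖ 1) := by
        rw [← Matrix.mul_kronecker_mul, mul_one]
      rw [h', ← hf, ← hf, ← hf, h]
      simp only [mul_assoc, Units.inv_mul_cancel_left])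
  have hF : ∀ X, F X = f X := fun _ => rfl
  have hinj : Function.Injective F := by
    intro X Y h
    refine inj ?_
    have h' : f X ⊗ₖ (1 : Matrix (ZMod m) (ZMod m) ℂ) = f Y ⊗ₖ 1 := by rw [← hF, h, hF]
    rw [← hf, ← hf] at h'
    exact M.mul_right_inj.1 ((M⁻¹).mul_left_inj.1 h')
  -- Surjectivity follows from injectivity by finite dimension.
  obtain ⟨A, hA⟩ := AlgEquiv.exists_eq_conj_generalLinearGroup (AlgEquiv.ofBijective F
    ⟨hinj, LinearMap.injective_iff_surjective (f := F.toLinearMap).1 hinj⟩)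
  exact ⟨A, fun X => by rw [hf, ← hA]; rfl⟩

theorem commute_conj_of_commute_conj_inv {R : Type*} [Monoid R] (M : Rˣ) {x y : R}
    (h : Commute x ((M⁻¹).val * y * M.val)) : Commute (M.val * x * (M⁻¹).val) y := by
  have h' := congrArg (fun z => M.val * z * (M⁻¹).val) h.eq
  simpa [mul_assoc, commute_iff_eq] using h'

/-! ### The coprime case. -/

section Coprime

theorem conj_eq_kronecker_one_of_coprime (hnm : Nat.gcd n m = 1) {x : InnerAut _}
    (hx : x ∈ pauliTensorNormalizer n m) {C : GL (ZMod n) ℂ} (hC : C ∈ heisenbergGroup n) :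
    ∃ C' ∈ heisenbergGroup n,
      x * Ad (tensorHom n m (C, 1)) * x⁻¹ = Ad (tensorHom n m (C', 1)) := by
  have h : x * Ad (tensorHom n m (C, 1)) * x⁻¹ ∈ pauliTensor n m :=
    (Subgroup.mem_normalizer_iff.1 hx _).1 (mem_adTensor.2 ⟨C, hC, 1, one_mem _, rfl⟩)
  obtain ⟨C', hC', D, hD, h⟩ := mem_adTensor.1 h
  refine ⟨C', hC', ?_⟩
  have hpow : Ad (tensorHom n m (C', D)) ^ n = 1 := by
    rw [h, conj_pow, ← map_pow, ← map_pow, Prod.pow_mk, one_pow,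
      Ad_tensorHom_eq_one_iff.2 ⟨by rw [map_pow, Ad_pow_eq_one hC], map_one _⟩, mul_one,
      mul_inv_cancel]
  rw [← map_pow, ← map_pow, Prod.pow_mk, Ad_tensorHom_eq_one_iff, map_pow, map_pow] at hpow
  -- The order of `Ad D` divides both `n` and `m`.
  have hD1 : Ad D = 1 := by
    have := pow_gcd_eq_one.2 ⟨hpow.2, Ad_pow_eq_one hD⟩
    rwa [hnm, pow_one] at this
  rw [← h, Ad_tensorHom_eq_iff]
  exact ⟨rfl, by rw [hD1, map_one]⟩

theorem conj_eq_one_kronecker_of_coprime (hnm : Nat.gcd n m = 1) {x : InnerAut _}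
    (hx : x ∈ pauliTensorNormalizer n m) {D : GL (ZMod m) ℂ} (hD : D ∈ heisenbergGroup m) :
    ∃ D' ∈ heisenbergGroup m,
      x * Ad (tensorHom n m (1, D)) * x⁻¹ = Ad (tensorHom n m (1, D')) := by
  have h : x * Ad (tensorHom n m (1, D)) * x⁻¹ ∈ pauliTensor n m :=
    (Subgroup.mem_normalizer_iff.1 hx _).1 (mem_adTensor.2 ⟨1, one_mem _, D, hD, rfl⟩)
  obtain ⟨C, hC, D', hD', h⟩ := mem_adTensor.1 h
  refine ⟨D', hD', ?_⟩
  have hpow : Ad (tensorHom n m (C, D')) ^ m = 1 := by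
    rw [h, conj_pow, ← map_pow, ← map_pow, Prod.pow_mk, one_pow,
      Ad_tensorHom_eq_one_iff.2 ⟨map_one _, by rw [map_pow, Ad_pow_eq_one hD]⟩, mul_one,
      mul_inv_cancel]
  rw [← map_pow, ← map_pow, Prod.pow_mk, Ad_tensorHom_eq_one_iff, map_pow, map_pow] at hpow
  have hC1 : Ad C = 1 := by
    have := pow_gcd_eq_one.2 ⟨Ad_pow_eq_one hC, hpow.1⟩
    rwa [hnm, pow_one] at this
  rw [← h, Ad_tensorHom_eq_iff]
  exact ⟨by rw [hC1, map_one], rfl⟩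

theorem mem_pauliNormalizer_of_coprime (hnm : Nat.gcd n m = 1) {A : GL (ZMod n) ℂ}
    {B : GL (ZMod m) ℂ} (h : Ad (tensorHom n m (A, B)) ∈ pauliTensorNormalizer n m) :
    Ad A ∈ pauliNormalizer n ∧ Ad B ∈ pauliNormalizer m := by
  have key (A : GL (ZMod n) ℂ) (B : GL (ZMod m) ℂ)
      (h : Ad (tensorHom n m (A, B)) ∈ pauliTensorNormalizer n m) :
      (∀ y ∈ pauliGroup n, Ad A * y * (Ad A)⁻¹ ∈ pauliGroup n) ∧
        ∀ y ∈ pauliGroup m, Ad B * y * (Ad B)⁻¹ ∈ pauliGroup m := by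
    constructor <;> intro y hy <;> rw [← map_Ad_heisenbergGroup] at hy
    · obtain ⟨C, hC, rfl⟩ := hy
      obtain ⟨C', hC', h'⟩ := conj_eq_kronecker_one_of_coprime hnm h hC
      rw [← map_inv, ← map_mul, ← map_mul, tensorHom_inv, tensorHom_mul_tensorHom,
        tensorHom_mul_tensorHom, Ad_tensorHom_eq_iff] at h'
      rw [← map_inv, ← map_mul, ← map_mul, h'.1]
      exact Ad_mem_pauliGroup_iff.2 ⟨C', hC', rfl⟩
    · obtain ⟨D, hD, rfl⟩ := hy
      obtain ⟨D', hD', h'⟩ := conj_eq_one_kronecker_of_coprime hnm h hD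
      rw [← map_inv, ← map_mul, ← map_mul, tensorHom_inv, tensorHom_mul_tensorHom,
        tensorHom_mul_tensorHom, Ad_tensorHom_eq_iff] at h'
      rw [← map_inv, ← map_mul, ← map_mul, h'.2]
      exact Ad_mem_pauliGroup_iff.2 ⟨D', hD', rfl⟩
  have h₁ := key A B h
  have h₂ := key A⁻¹ B⁻¹ (by rw [← tensorHom_inv, map_inv]; exact inv_mem h)
  simp only [map_inv, inv_inv] at h₂
  exact ⟨Subgroup.mem_normalizer_of_conj_mem h₁.1 h₂.1,
    Subgroup.mem_normalizer_of_conj_mem h₁.2 h₂.2⟩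

theorem exists_eq_tensorHom_of_coprime (hnm : Nat.gcd n m = 1) {M : GL (ZMod n × ZMod m) ℂ}
    (hM : Ad M ∈ pauliTensorNormalizer n m) :
    ∃ A B, M = tensorHom n m (A, B) := by
  have hcomm (X : Matrix (ZMod n) (ZMod n) ℂ) (D : GL (ZMod m) ℂ) (hD : D ∈ heisenbergGroup m) :
      Commute (M.val * (X ⊗ₖ (1 : Matrix (ZMod m) (ZMod m) ℂ)) * (M⁻¹).val)
        (tensorHom n m (1, D)).val := by
    obtain ⟨D', -, h⟩ := conj_eq_one_kronecker_of_coprime hnm (inv_mem hM) hD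
    rw [inv_inv, ← map_inv, ← map_mul, ← map_mul, Ad_eq_Ad_iff] at h
    obtain ⟨c, hc⟩ := h
    refine commute_conj_of_commute_conj_inv M ?_
    rw [← Units.val_mul, ← Units.val_mul, hc]
    -- The scalar ambiguity in lifting from `Ad` does not affect commutation.
    exact (kronecker_one_commute_one_kronecker X D'.val).smul_right c
  obtain ⟨A, hA⟩ := exists_conj_kronecker_one (M := M) fun X =>
    exists_eq_kronecker_one (hcomm X _ pauliQ_mem) (hcomm X _ pauliP_mem)
  set N : GL (ZMod n × ZMod m) ℂ := (tensorHom n m (A, 1))⁻¹ * M with hN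
  have hNcomm (C : GL (ZMod n) ℂ) : Commute N (tensorHom n m (C, 1)) := by
    have h : M * tensorHom n m (C, 1) * M⁻¹ =
        tensorHom n m (A, 1) * tensorHom n m (C, 1) * (tensorHom n m (A, 1))⁻¹ := by
      rw [tensorHom_inv, tensorHom_mul_tensorHom, tensorHom_mul_tensorHom]
      refine Units.ext ?_
      simpa [tensorHom_val] using hA C.val
    rw [commute_iff_eq, hN, mul_assoc, mul_inv_eq_iff_eq_mul.1 h]
    group
  have hNval (N : GL (ZMod n × ZMod m) ℂ)
      (h : ∀ C : GL (ZMod n) ℂ, Commute N (tensorHom n m (C, 1))) :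
      ∃ Y : Matrix (ZMod m) (ZMod m) ℂ, N.val = (1 : Matrix (ZMod n) (ZMod n) ℂ) ⊗ₖ Y :=
    exists_eq_one_kronecker (congrArg Units.val (h (pauliQ n)).eq)
      (congrArg Units.val (h (pauliP n)).eq)
  obtain ⟨B, hB⟩ := hNval N hNcomm
  -- Treating `N⁻¹` as well supplies the inverse of `B`.
  obtain ⟨B', hB'⟩ := hNval N⁻¹ fun C => (hNcomm C).inv_left
  have hBB' : B * B' = 1 := one_kronecker_injective (ι := ZMod n) <| by
    simpa [hB, hB', ← Matrix.mul_kronecker_mul] using N.mul_inv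
  have hB'B : B' * B = 1 := one_kronecker_injective (ι := ZMod n) <| by
    simpa [hB, hB', ← Matrix.mul_kronecker_mul] using N.inv_mul
  refine ⟨A, ⟨B, B', hBB', hB'B⟩, ?_⟩
  have hN' : N = tensorHom n m (1, ⟨B, B', hBB', hB'B⟩) := Units.ext hB
  rw [← mul_inv_cancel_left (tensorHom n m (A, 1)) M, ← hN, hN', tensorHom_mul_tensorHom,
    mul_one, one_mul]

theorem pauliTensorNormalizer_le_of_coprime (hnm : Nat.gcd n m = 1) :
    pauliTensorNormalizer n m ≤ normalizerTensor n m := by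
  intro x hx
  obtain ⟨M, rfl⟩ := MonoidHom.rangeRestrict_surjective (MulAut.conj (G := GL (ZMod n × ZMod m) ℂ)) x
  change Ad M ∈ _ at hx
  obtain ⟨A, B, rfl⟩ := exists_eq_tensorHom_of_coprime hnm hx
  obtain ⟨hA, hB⟩ := mem_pauliNormalizer_of_coprime hnm hx
  exact mem_adTensor.2 ⟨A, hA, B, hB, rfl⟩

end Coprime

/-! ### The non-coprime case: a normalizing matrix that does not factor. -/

section PhaseGate

/-- The diagonal matrix with entries `ζ ^ (i * j)`, as an element of `GL(nm, ℂ)`. -/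
noncomputable def phaseGate (n m : ℕ) [NeZero n] [NeZero m] (ζ : ℂˣ) :
    GL (ZMod n × ZMod m) ℂ where
  val := Matrix.diagonal fun p => (ζ : ℂ) ^ (p.1.val * p.2.val)
  inv := Matrix.diagonal fun p => ((ζ⁻¹ : ℂˣ) : ℂ) ^ (p.1.val * p.2.val)
  val_inv := by simp [Matrix.diagonal_mul_diagonal]
  inv_val := by simp [Matrix.diagonal_mul_diagonal]

theorem phaseGate_inv (ζ : ℂˣ) : (phaseGate n m ζ)⁻¹ = phaseGate n m ζ⁻¹ := rfl

theorem phaseGate_commute {A : GL (ZMod n × ZMod m) ℂ} {a : ZMod n × ZMod m → ℂ}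
    (hA : A.val = Matrix.diagonal a) (ζ : ℂˣ) : Commute (phaseGate n m ζ) A := by
  refine Units.ext ?_
  rw [Units.val_mul, Units.val_mul, hA, phaseGate, Matrix.diagonal_mul_diagonal,
    Matrix.diagonal_mul_diagonal]
  simp only [mul_comm]

theorem phaseGate_mul_pauliQ_left (ζ : ℂˣ) :
    phaseGate n m ζ * tensorHom n m (pauliQ n, 1) * (phaseGate n m ζ)⁻¹ =
      tensorHom n m (pauliQ n, 1) := by
  rw [mul_inv_eq_iff_eq_mul]
  refine phaseGate_commute (a := fun p => omegaRoot n ^ p.1.val) ?_ ζ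
  rw [tensorHom_val, pauliQ, Units.val_one, ← Matrix.diagonal_one,
    Matrix.diagonal_kronecker_diagonal]
  simp

theorem phaseGate_mul_pauliQ_right (ζ : ℂˣ) :
    phaseGate n m ζ * tensorHom n m (1, pauliQ m) * (phaseGate n m ζ)⁻¹ =
      tensorHom n m (1, pauliQ m) := by
  rw [mul_inv_eq_iff_eq_mul]
  refine phaseGate_commute (a := fun p => omegaRoot m ^ p.2.val) ?_ ζ
  rw [tensorHom_val, pauliQ, Units.val_one, ← Matrix.diagonal_one,
    Matrix.diagonal_kronecker_diagonal]
  simp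

/-- Passing from `i` to `i + 1` changes the phase by `ζ ^ j`, so conjugation leaves the factor `ζ⁻¹
^ j`, the diagonal of `Q_m ^ k`. -/
theorem phaseGate_mul_pauliP_left {ζ : ℂˣ} (hn : (ζ : ℂ) ^ n = 1) {k : ℕ}
    (hk : omegaRoot m ^ k = ((ζ⁻¹ : ℂˣ) : ℂ)) :
    phaseGate n m ζ * tensorHom n m (pauliP n, 1) * (phaseGate n m ζ)⁻¹ =
      tensorHom n m (pauliP n, pauliQ m ^ k) := by
  rw [mul_inv_eq_iff_eq_mul]
  refine Units.ext ?_
  rw [Units.val_mul, Units.val_mul, tensorHom_val, tensorHom_val, pauliQ_pow_val, hk]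
  ext ⟨i, j⟩ ⟨i', j'⟩
  simp only [phaseGate, Matrix.mul_diagonal, Matrix.diagonal_mul, Matrix.kroneckerMap_apply,
    pauliP, Matrix.of_apply, Units.val_one, Matrix.one_apply, Matrix.diagonal_apply,
    eq_sub_iff_add_eq]
  split_ifs with h₁ h₂ <;> try simp
  subst h₁ h₂
  rw [pow_mul, pow_mul, pow_val_add_one hn, mul_pow, mul_left_comm]
  simp

theorem phaseGate_mul_pauliP_right {ζ : ℂˣ} (hm : (ζ : ℂ) ^ m = 1) {k : ℕ}
    (hk : omegaRoot n ^ k = ((ζ⁻¹ : ℂˣ) : ℂ)) :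
    phaseGate n m ζ * tensorHom n m (1, pauliP m) * (phaseGate n m ζ)⁻¹ =
      tensorHom n m (pauliQ n ^ k, pauliP m) := by
  rw [mul_inv_eq_iff_eq_mul]
  refine Units.ext ?_
  rw [Units.val_mul, Units.val_mul, tensorHom_val, tensorHom_val, pauliQ_pow_val, hk]
  ext ⟨i, j⟩ ⟨i', j'⟩
  simp only [phaseGate, Matrix.mul_diagonal, Matrix.diagonal_mul, Matrix.kroneckerMap_apply,
    pauliP, Matrix.of_apply, Units.val_one, Matrix.one_apply, Matrix.diagonal_apply,
    eq_sub_iff_add_eq]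
  split_ifs with h₁ h₂ <;> try simp
  subst h₁ h₂
  rw [mul_comm i.val, mul_comm i.val, pow_mul, pow_mul, pow_val_add_one hm, mul_pow,
    mul_left_comm]
  simp

theorem Ad_phaseGate_conj_mem {ζ : ℂˣ} (hn : (ζ : ℂ) ^ n = 1) (hm : (ζ : ℂ) ^ m = 1) :
    ∀ h ∈ pauliTensor n m,
      Ad (phaseGate n m ζ) * h * (Ad (phaseGate n m ζ))⁻¹ ∈ pauliTensor n m := by
  obtain ⟨k, -, hk⟩ := (isPrimitiveRoot_omegaRoot n).eq_pow_of_pow_eq_one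
    (ξ := ((ζ⁻¹ : ℂˣ) : ℂ)) (by simp [hn])
  obtain ⟨l, -, hl⟩ := (isPrimitiveRoot_omegaRoot m).eq_pow_of_pow_eq_one
    (ξ := ((ζ⁻¹ : ℂˣ) : ℂ)) (by simp [hm])
  set S : Subgroup (GL (ZMod n × ZMod m) ℂ) := (pauliTensor n m).comap
    (Ad.comp (MulAut.conj (phaseGate n m ζ)).toMonoidHom)
  have hS (A : GL (ZMod n) ℂ) (B : GL (ZMod m) ℂ) : tensorHom n m (A, B) ∈ S ↔
      Ad (phaseGate n m ζ * tensorHom n m (A, B) * (phaseGate n m ζ)⁻¹) ∈ pauliTensor n m := Iff.rfl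
  have hleft : heisenbergGroup n ≤ S.comap ((tensorHom n m).comp (MonoidHom.inl _ _)) := by
    refine (Subgroup.closure_le _).2 ?_
    rintro _ (rfl | rfl)
    · refine (hS _ _).2 ?_
      rw [phaseGate_mul_pauliQ_left]
      exact mem_adTensor.2 ⟨_, pauliQ_mem, _, one_mem _, rfl⟩
    · refine (hS _ _).2 ?_
      rw [phaseGate_mul_pauliP_left hn hl]
      exact mem_adTensor.2 ⟨_, pauliP_mem, _, pow_mem pauliQ_mem l, rfl⟩
  have hright : heisenbergGroup m ≤ S.comap ((tensorHom n m).comp (MonoidHom.inr _ _)) := by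
    refine (Subgroup.closure_le _).2 ?_
    rintro _ (rfl | rfl)
    · refine (hS _ _).2 ?_
      rw [phaseGate_mul_pauliQ_right]
      exact mem_adTensor.2 ⟨_, one_mem _, _, pauliQ_mem, rfl⟩
    · refine (hS _ _).2 ?_
      rw [phaseGate_mul_pauliP_right hm hk]
      exact mem_adTensor.2 ⟨_, pow_mem pauliQ_mem k, _, pauliP_mem, rfl⟩
  intro h hh
  obtain ⟨A, hA, B, hB, rfl⟩ := mem_adTensor.1 hh
  -- Split `A ⊗ B = (A ⊗ 1)(1 ⊗ B)` to use the two generator checks.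
  rw [← map_inv, ← map_mul, ← map_mul, ← hS, ← mul_one A, ← one_mul B, ← tensorHom_mul_tensorHom]
  exact mul_mem (hleft hA) (hright hB)

theorem Ad_phaseGate_mem_pauliTensorNormalizer {ζ : ℂˣ} (hn : (ζ : ℂ) ^ n = 1)
    (hm : (ζ : ℂ) ^ m = 1) : Ad (phaseGate n m ζ) ∈ pauliTensorNormalizer n m := by
  refine Subgroup.mem_normalizer_of_conj_mem (Ad_phaseGate_conj_mem hn hm) fun h hh => ?_
  have := Ad_phaseGate_conj_mem (n := n) (m := m) (ζ := ζ⁻¹) (by simp [hn]) (by simp [hm]) h hh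
  rwa [← phaseGate_inv, map_inv, inv_inv] at this

/-- The diagonal entries `f i j` of a multiple of a tensor product satisfy `f 0 0 * f 1 1 = f 0 1 *
f 1 0`; here this reads `ζ = 1`. -/
theorem Ad_phaseGate_ne_Ad_tensorHom (hn : n ≠ 1) (hm : m ≠ 1) {ζ : ℂˣ} (hζ : ζ ≠ 1)
    (A : GL (ZMod n) ℂ) (B : GL (ZMod m) ℂ) :
    Ad (phaseGate n m ζ) ≠ Ad (tensorHom n m (A, B)) := by
  intro h
  obtain ⟨c, hc⟩ := Ad_eq_Ad_iff.1 h
  have hc' (i j) := congrFun (congrFun hc (i, j)) (i, j)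
  simp only [phaseGate, Matrix.diagonal_apply_eq, Matrix.smul_apply, tensorHom_val,
    Matrix.kroneckerMap_apply, smul_eq_mul] at hc'
  have h₀₀ := hc' 0 0
  have h₀₁ := hc' 0 1
  have h₁₀ := hc' 1 0
  have h₁₁ := hc' 1 1
  have hn1 : (1 : ZMod n).val = 1 := ZMod.val_one'' hn
  have hm1 : (1 : ZMod m).val = 1 := ZMod.val_one'' hm
  simp only [ZMod.val_zero, hn1, hm1, mul_zero, mul_one, pow_zero, pow_one]
    at h₀₀ h₀₁ h₁₀ h₁₁
  refine hζ (Units.ext ?_)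
  calc (ζ : ℂ) = 1 * (ζ : ℂ) := (one_mul _).symm
    _ = (c * (A.val 0 0 * B.val 1 1)) * (c * (A.val 1 1 * B.val 0 0)) := by
        rw [h₀₀, h₁₁]; ring
    _ = 1 := by rw [← h₀₁, ← h₁₀, one_mul]

theorem not_pauliTensorNormalizer_le (hnm : Nat.gcd n m ≠ 1) :
    ¬ pauliTensorNormalizer n m ≤ normalizerTensor n m := by
  intro hle
  have hd : Nat.gcd n m ≠ 0 := (Nat.gcd_pos_of_pos_left m (NeZero.pos n)).ne'
  have hprim := Complex.isPrimitiveRoot_exp _ hd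
  set ζ : ℂˣ := (hprim.isUnit hd).unit with hζ
  have hζv : (ζ : ℂ) = _ := (hprim.isUnit hd).unit_spec
  have hζ1 : ζ ≠ 1 := fun h => hnm <| hprim.unique <| by
    rw [← hζv, h, Units.val_one]
    exact IsPrimitiveRoot.one
  obtain ⟨A, -, B, -, h⟩ := mem_adTensor.1 (hle (Ad_phaseGate_mem_pauliTensorNormalizer (ζ := ζ)
    (by rw [hζv]; exact (hprim.pow_eq_one_iff_dvd n).2 (Nat.gcd_dvd_left n m))
    (by rw [hζv]; exact (hprim.pow_eq_one_iff_dvd m).2 (Nat.gcd_dvd_right n m))))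
  refine Ad_phaseGate_ne_Ad_tensorHom ?_ ?_ hζ1 A B h.symm
  · rintro rfl; simp at hnm
  · rintro rfl; simp at hnm

end PhaseGate

end Tensor

theorem corollary38 (n m : ℕ) [NeZero n] [NeZero m] :
    pauliTensorNormalizer n m = normalizerTensor n m ↔ Nat.gcd n m = 1 := by
  constructor
  · intro h
    by_contra hnm
    exact not_pauliTensorNormalizer_le hnm h.le
  · intro h
    exact le_antisymm (pauliTensorNormalizer_le_of_coprime h) normalizerTensor_le
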